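/- Let $n>1$ be odd and let $C\ell(n)$ be the real Clifford algebra generated by $\mathbf e_1,\dots,\mathbf e_n$ with $\mathbf e_i\mathbf e_j+\mathbf e_j\mathbf e_i=-2\delta_{ij}$. Identify $(x_0,\dots,x_n)\in\mathbb R^{n+1}$ with the paravector $x=x_0+\mathbf x$, $\mathbf x=\sum_{i=1}^n x_i\mathbf e_i$, and put $\overline x=x_0-\mathbf x$ and $|\mathbf x|=(\sum_{i=1}^n x_i^2)^{1/2}$. For a holomorphic function $f(w+\mathrm iy)=u(w,y)+\mathrm i\,v(w,y)$ and a real constant $\alpha_n[f]$, the Fueter–Sce transform of $f$ is $$\tau_n[f](x)=\alpha_n[f]\left(\Big(\tfrac1r\,\partial_r\Big)^{\frac{n-1}2}u(x_0,r)+\frac{\mathbf x}{|\mathbf x|}\Big(\partial_r\,\tfrac1r\Big)^{\frac{n-1}2}v(x_0,r)\right)\Bigg|_{r=|\mathbf x|}\qquad(\mathbf x\neq0),$$ extended by continuity to the paravectors with $\mathbf x=0$. For the monomials $z^l$, $l\ge n-1$, take $$\alpha_n[z^l]=(-1)^{\frac{n-1}2}\,\frac{(n-2)!!\,(l-n+1)!}{l!}.$$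 For every integer $k\ge0$ there is exactly one function $P_k^n:\mathbb R^{n+1}\to C\ell(n)$ (the Appell polynomial of Malonek, Cruz and Falcão) that has the form $$P^n_k(x)=\sum_{s=0}^k T_s\,x^{k-s}\,\overline x^{\,s}\quad\text{with real constants }T_s,\qquad P_k^n(1)=1,$$ and is $C\ell(n)$-holomorphic, i.e. $\big(\partial_{x_0}+\sum_{i=1}^n\mathbf e_i\,\partial_{x_i}\big)P_k^n=0$ on $\mathbb R^{n+1}$. These polynomials form an Appell sequence with respect to the hypercomplex derivative: $\tfrac12\big(\partial_{x_0}-\sum_{i=1}^n\mathbf e_i\,\partial_{x_i}\big)P_k^n=k\,P_{k-1}^n$ for $k\ge1$, and the left-hand side is $0$ for $k=0$. Moreover, for every $k\ge0$, the Fueter–Sce transform of $z^{k+n-1}$ is defined on all of $\mathbb R^{n+1}$ (the continuous extension to $\mathbf x=0$ exists and is unique), and $$\tau_n\left[z^{k+n-1}\right](x)=P_k^n(x)\qquad\text{for all paravectors }x .$$ -/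

import Mathlib

namespace FueterSce

noncomputable section

/-- The quadratic form `v ↦ -(v₁² + ⋯ + vₙ²)` on `ℝⁿ`. -/
abbrev negSq (n : ℕ) : QuadraticForm ℝ (Fin n → ℝ) :=
  QuadraticMap.weightedSumSquares ℝ (fun _ : Fin n => (-1 : ℝ))

/-- The real Clifford algebra `Cℓ(n)`, with `eᵢ eⱼ + eⱼ eᵢ = -2 δᵢⱼ`. -/
abbrev Cl (n : ℕ) : Type := CliffordAlgebra (negSq n)

/-- The space `ℝⁿ⁺¹` of paravectors, written as pairs (scalar part `x₀`, vector part). -/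
abbrev Paravector (n : ℕ) : Type := ℝ × (Fin n → ℝ)

/-- The vector `v₁ e₁ + ⋯ + vₙ eₙ` as an element of `Cℓ(n)`. -/
def vec {n : ℕ} (v : Fin n → ℝ) : Cl n := CliffordAlgebra.ι (negSq n) v

/-- The basis vector `eᵢ` as an element of `Cℓ(n)`. -/
def e {n : ℕ} (i : Fin n) : Cl n := vec (Pi.single i 1)

/-- The Euclidean length of a vector. -/
def vecNorm {n : ℕ} (v : Fin n → ℝ) : ℝ := Real.sqrt (∑ i, v i ^ 2)

/-- The embedding of paravectors, `(x₀, 𝐱) ↦ x₀ + 𝐱 ∈ Cℓ(n)`. -/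
def toCl {n : ℕ} (x : Paravector n) : Cl n := algebraMap ℝ (Cl n) x.1 + vec x.2

/-- The conjugate paravector `x₀ - 𝐱 ∈ Cℓ(n)`. -/
def conjCl {n : ℕ} (x : Paravector n) : Cl n := algebraMap ℝ (Cl n) x.1 - vec x.2

/-! Calculus for functions with values in the finite-dimensional real vector space `Cℓ(n)`,
on which Mathlib puts no topology: everything is tested on all linear functionals, that is,
on all real components. -/

/-- `F` is continuous on `ℝⁿ⁺¹`. -/
def ContinuousCl {n : ℕ} (F : Paravector n → Cl n) : Prop :=
  ∀ L : Module.Dual ℝ (Cl n), Continuous fun x => L (F x)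

/-- `w` is the derivative of `F` at `x` in direction `h`. -/
def HasDirDeriv {n : ℕ} (F : Paravector n → Cl n) (x h : Paravector n) (w : Cl n) : Prop :=
  ∀ L : Module.Dual ℝ (Cl n), HasDerivAt (fun t : ℝ => L (F (x + t • h))) (L w) 0

/-- `d₀, d 1, …, d n` are the partial derivatives of `F` at `x` with respect to
`x₀, x₁, …, xₙ`. -/
def HasPartialDerivs {n : ℕ} (F : Paravector n → Cl n) (x : Paravector n)
    (d₀ : Cl n) (d : Fin n → Cl n) : Prop :=
  HasDirDeriv F x (1, 0) d₀ ∧ ∀ i, HasDirDeriv F x (0, Pi.single i 1) (d i)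

/-- `F` is `Cℓ(n)`-holomorphic (monogenic) on `ℝⁿ⁺¹`: it is in the kernel of the generalized
Cauchy–Riemann operator `∂₀ + ∑ᵢ eᵢ ∂ᵢ`. -/
def IsMonogenic {n : ℕ} (F : Paravector n → Cl n) : Prop :=
  ∀ x, ∃ (d₀ : Cl n) (d : Fin n → Cl n),
    HasPartialDerivs F x d₀ d ∧ d₀ + ∑ i, e i * d i = 0

/-- `w` is the hypercomplex derivative `½ (∂₀ - ∑ᵢ eᵢ ∂ᵢ) F` at `x`. -/
def HasHypercomplexDeriv {n : ℕ} (F : Paravector n → Cl n) (x : Paravector n)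
    (w : Cl n) : Prop :=
  ∃ (d₀ : Cl n) (d : Fin n → Cl n),
    HasPartialDerivs F x d₀ d ∧ w = (1 / 2 : ℝ) • (d₀ - ∑ i, e i * d i)

/-- The defining properties of the Malonek–Cruz–Falcão polynomial `P_k^n`: it is of the form
`∑_{s ≤ k} T_s x^{k-s} x̄^s` with real constants `T_s`, it takes the value `1` at `1`, and it is
`Cℓ(n)`-holomorphic. -/
def IsAppellPolynomial (n k : ℕ) (P : Paravector n → Cl n) : Prop :=
  (∃ T : ℕ → ℝ, ∀ x, P x =
    ∑ s ∈ Finset.range (k + 1), T s • (toCl x ^ (k - s) * conjCl x ^ s)) ∧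
  P (1, 0) = 1 ∧ IsMonogenic P

/-- The operator `(1/r) ∂_r`. -/
def invMulDeriv (g : ℝ → ℝ) : ℝ → ℝ := fun r => (1 / r) * deriv g r

/-- The operator `∂_r (1/r)`. -/
def derivInvMul (g : ℝ → ℝ) : ℝ → ℝ := deriv fun r => (1 / r) * g r

/-- The Fueter–Sce formula for `f = u + i v` with constant `α`, at a paravector `x = x₀ + 𝐱` with
`𝐱 ≠ 0`:
`α (((1/r) ∂_r)^{(n-1)/2} u(x₀, r) + (𝐱/|𝐱|) (∂_r (1/r))^{(n-1)/2} v(x₀, r))` at `r = |𝐱|`. -/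
def fueterSceFormula (n : ℕ) (α : ℝ) (f : ℂ → ℂ) (x : Paravector n) : Cl n :=
  α • (algebraMap ℝ (Cl n)
        ((invMulDeriv^[(n - 1) / 2] fun r : ℝ => (f ⟨x.1, r⟩).re) (vecNorm x.2)) +
      ((1 / vecNorm x.2) • vec x.2) *
        algebraMap ℝ (Cl n)
          ((derivInvMul^[(n - 1) / 2] fun r : ℝ => (f ⟨x.1, r⟩).im) (vecNorm x.2)))

/-- `F` is the Fueter–Sce transform of `f` with constant `α`, on all of `ℝⁿ⁺¹`: it is given by the
Fueter–Sce formula where `𝐱 ≠ 0`, and by continuity where `𝐱 = 0`. -/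
def IsFueterSceTransform (n : ℕ) (α : ℝ) (f : ℂ → ℂ) (F : Paravector n → Cl n) : Prop :=
  (∀ x : Paravector n, x.2 ≠ 0 → F x = fueterSceFormula n α f x) ∧ ContinuousCl F

/-- The normalisation constant `α_n[z^l] = (-1)^{(n-1)/2} (n-2)!! (l-n+1)! / l!`, used for
`l ≥ n - 1` and odd `n > 1`. -/
def alpha (n l : ℕ) : ℝ :=
  (-1) ^ ((n - 1) / 2) * ((Nat.doubleFactorial (n - 2) : ℝ) * (Nat.factorial (l + 1 - n) : ℝ)) /
    (Nat.factorial l : ℝ)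

end

end FueterSce

/-!
The proof works with the homogeneous polynomials `∑_{j ≤ k} c_j x₀^{k-j} 𝐱^j` (`axialPoly`). As
`x = x₀ + 𝐱` and `x̄ = x₀ - 𝐱` commute and span the same plane as `x₀` and `𝐱`, these are exactly
the functions `∑ T_s x^{k-s} x̄^s` (`exists_toCl_conjCl_iff`).

Since `𝐱² = -|𝐱|²`, the Dirac operator acts on powers by `(∑ᵢ eᵢ ∂ᵢ) 𝐱^j = -κ_j 𝐱^{j-1}`, where
`κ_j` is `j` for even `j` and `j + n - 1` for odd `j` (`exists_partialDerivs_vec_pow`). Hence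
`∑ c_j x₀^{k-j} 𝐱^j` is monogenic if and only if `κ_{j+1} c_{j+1} = (k - j) c_j` for all `j < k`
(`isMonogenic_axialPoly_iff`), and together with `c_0 = 1`, the value at `1`, this recurrence has
exactly one solution, `appellCoeff`. For a monogenic function the hypercomplex derivative is `∂₀`,
so that the Appell property is the identity `sub_mul_appellCoeff` between coefficients.

Write `n = 2m + 1` and `l = k + 2m`. The real and imaginary parts of `(w + i r)^l` are `U(r²)` and
`r V(r²)` for polynomials `U`, `V`. Both radial operators act as `2 d/dq` in the variable `q = r²`,
so the Fueter–Sce formula gives a multiple of `U⁽ᵐ⁾(|𝐱|²) + 𝐱 V⁽ᵐ⁾(|𝐱|²)`, which is again of the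
form `∑ c_j x₀^{k-j} 𝐱^j`. Its coefficients, `C(l, j + 2m)` times a falling factorial, satisfy the
same recurrence, and `alpha` is the constant that makes `c_0 = 1`
(`alpha_mul_choose_eq_appellCoeff`). The extension to `𝐱 = 0` is unique as `𝐱 ≠ 0` is dense.
-/

namespace FueterSce

open scoped Polynomial Pointwise

noncomputable section

/-! ### Homogeneous polynomials in two commuting elements -/

/-- The `k`-th power of the plane spanned by two commuting elements `a`, `b` consists of the
homogeneous polynomials of degree `k` in `a` and `b`. It depends on the plane alone, which gives the
change of basis from `x`, `x̄` to `x₀`, `𝐱`. -/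
theorem mem_span_pair_pow_iff {A : Type*} [Ring A] [Algebra ℝ A] {a b : A} (hab : Commute a b)
    (k : ℕ) (y : A) :
    y ∈ Submodule.span ℝ {a, b} ^ k ↔
      ∃ T : ℕ → ℝ, y = ∑ s ∈ Finset.range (k + 1), T s • (a ^ (k - s) * b ^ s) := by
  constructor
  · intro hy
    have key : ({a, b} : Set A) ^ k ⊆
        ((fun s => a ^ (k - s) * b ^ s) '' (Finset.range (k + 1) : Set ℕ)) := by
      clear hy
      induction k with
      | zero => intro z hz; simpa using hz
      | succ k ih =>
        rw [pow_succ]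
        rintro _ ⟨z, hz, w, hw, rfl⟩
        obtain ⟨s, hs, rfl⟩ := ih hz
        have hs' : s ≤ k := by simpa [Nat.lt_succ_iff] using hs
        rcases hw with rfl | rfl
        · refine ⟨s, by simp; omega, ?_⟩
          have : k + 1 - s = (k - s) + 1 := by omega
          simp only [this, pow_succ, mul_assoc, (hab.pow_right s).eq]
        · refine ⟨s + 1, by simp; omega, ?_⟩
          simp [pow_succ, mul_assoc]
    rw [Submodule.span_pow] at hy
    have := Submodule.span_mono key hy
    rw [Submodule.mem_span_image_finset_iff_exists_fun'] at this
    obtain ⟨T, hT⟩ := this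
    exact ⟨T, hT.symm⟩
  · rintro ⟨T, rfl⟩
    refine Submodule.sum_mem _ fun s hs => Submodule.smul_mem _ _ ?_
    have hs' : k = (k - s) + s := by have := Finset.mem_range.1 hs; omega
    rw [hs', pow_add]
    simp only [add_tsub_cancel_right]
    exact Submodule.mul_mem_mul (Submodule.pow_mem_pow _ (Submodule.subset_span (by simp)) _)
      (Submodule.pow_mem_pow _ (Submodule.subset_span (by simp)) _)

/-! ### The Clifford algebra -/

variable {n : ℕ}

instance : Nontrivial (Cl n) :=
  haveI : Invertible (2 : ℝ) := invertibleOfNonzero two_ne_zero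
  inferInstance

theorem vec_add (v w : Fin n → ℝ) : vec (v + w) = vec v + vec w := map_add _ _ _

theorem vec_smul (t : ℝ) (v : Fin n → ℝ) : vec (t • v) = t • vec v := map_smul _ _ _

theorem vec_zero : vec (0 : Fin n → ℝ) = 0 := map_zero _

theorem vec_eq_sum (v : Fin n → ℝ) : vec v = ∑ i, v i • e i := by
  simp only [e, ← vec_smul]
  simp only [vec, ← map_sum]
  congr 1
  ext j
  simp [Finset.sum_apply, Pi.single_apply]

theorem vec_sq (v : Fin n → ℝ) : vec v ^ 2 = -(∑ i, v i ^ 2) • (1 : Cl n) := by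
  rw [sq, vec, CliffordAlgebra.ι_sq_scalar, Algebra.algebraMap_eq_smul_one]
  simp [QuadraticMap.weightedSumSquares_apply, sq]

theorem vec_pow_add_two (v : Fin n → ℝ) (j : ℕ) :
    vec v ^ (j + 2) = -(∑ i, v i ^ 2) • vec v ^ j := by
  rw [pow_add, vec_sq, mul_smul_comm, mul_one]

theorem e_mul_e (i : Fin n) : e i * e i = -(1 : Cl n) := by
  rw [← sq, e, vec_sq]
  simp [Pi.single_apply, ite_pow]

theorem e_pow_ne_zero (i : Fin n) (j : ℕ) : (e i : Cl n) ^ j ≠ 0 := by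
  have h : IsUnit (e i : Cl n) :=
    ⟨⟨e i, -e i, by simp [e_mul_e], by simp [e_mul_e]⟩, rfl⟩
  exact (h.pow j).ne_zero

theorem vecNorm_sq (v : Fin n → ℝ) : vecNorm v ^ 2 = ∑ i, v i ^ 2 :=
  Real.sq_sqrt (Finset.sum_nonneg fun _ _ => sq_nonneg _)

theorem vecNorm_pos {v : Fin n → ℝ} (hv : v ≠ 0) : 0 < vecNorm v := by
  obtain ⟨i, hi⟩ := Function.ne_iff.1 hv
  exact Real.sqrt_pos.2 (Finset.sum_pos' (fun _ _ => sq_nonneg _)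
    ⟨i, Finset.mem_univ _, by have : v i ≠ 0 := hi; positivity⟩)

/-- The linear functionals separate the points of `Cℓ(n)`; this carries uniqueness of
derivatives and of continuous extensions over to calculus tested on linear functionals. -/
theorem eq_of_forall_dual {a b : Cl n} (h : ∀ L : Module.Dual ℝ (Cl n), L a = L b) : a = b := by
  rw [← sub_eq_zero]
  exact (Module.forall_dual_apply_eq_zero_iff ℝ _).1 fun L => by rw [map_sub, h, sub_self]

/-! ### Directional derivatives -/

variable {F : Paravector n → Cl n} {x h : Paravector n} {w w' : Cl n}

theorem HasDirDeriv.unique (h₁ : HasDirDeriv F x h w) (h₂ : HasDirDeriv F x h w') : w = w' :=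
  eq_of_forall_dual fun L => (h₁ L).unique (h₂ L)

theorem HasDirDeriv.smul {g : Paravector n → ℝ} {g' : ℝ}
    (hg : HasDerivAt (fun t : ℝ => g (x + t • h)) g' 0) (hF : HasDirDeriv F x h w) :
    HasDirDeriv (fun y => g y • F y) x h (g' • F x + g x • w) := fun L => by
  simpa using hg.fun_mul (hF L)

theorem HasDirDeriv.sum {ι : Type*} {s : Finset ι} {F : ι → Paravector n → Cl n} {w : ι → Cl n}
    (hF : ∀ i ∈ s, HasDirDeriv (F i) x h (w i)) :
    HasDirDeriv (fun y => ∑ i ∈ s, F i y) x h (∑ i ∈ s, w i) := fun L => by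
  simpa using HasDerivAt.fun_sum fun i hi => hF i hi L

theorem hasDirDeriv_vec (x : Paravector n) (a : ℝ) (v : Fin n → ℝ) :
    HasDirDeriv (fun y => vec y.2) x (a, v) (vec v) := fun L => by
  have := ((hasDerivAt_id (0 : ℝ)).mul_const (L (vec v))).const_add (L (vec x.2))
  simpa [vec_add, vec_smul] using this

theorem hasDirDeriv_of_forall_eq (hF : ∀ t : ℝ, F (x + t • h) = F x) : HasDirDeriv F x h 0 :=
  fun L => by simpa [hF] using hasDerivAt_const (0 : ℝ) (L (F x))

theorem hasDerivAt_sum_sq (x : Paravector n) (i : Fin n) :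
    HasDerivAt (fun t : ℝ => -∑ m, (x + t • ((0, Pi.single i 1) : Paravector n)).2 m ^ 2)
      (-(2 * x.2 i)) 0 := by
  have h : ∀ m ∈ Finset.univ, HasDerivAt
      (fun t : ℝ => (x.2 m + t * (Pi.single i 1 : Fin n → ℝ) m) ^ 2)
      (2 * x.2 m * (Pi.single i 1 : Fin n → ℝ) m) 0 := fun m _ => by
    simpa using (((hasDerivAt_id (0 : ℝ)).mul_const
      ((Pi.single i 1 : Fin n → ℝ) m)).const_add (x.2 m)).fun_pow 2
  simpa [Pi.single_apply] using (HasDerivAt.fun_sum h).fun_neg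

/-- The factor `κ_j` in `(∑ᵢ eᵢ ∂ᵢ) 𝐱^j = -κ_j 𝐱^{j-1}`. -/
def diracFactor (n j : ℕ) : ℝ := if Even j then j else j + (n - 1)

theorem diracFactor_add_two (n j : ℕ) : diracFactor n (j + 2) = diracFactor n j + 2 := by
  simp only [diracFactor, Nat.even_add, even_two, iff_true]
  split_ifs <;> push_cast <;> ring

/-- The formula `(∑ᵢ eᵢ ∂ᵢ) 𝐱^j = -κ_j 𝐱^{j-1}`, by induction from `𝐱^{j+2} = -|𝐱|² 𝐱^j`. For `j = 0`
the truncated exponent `j - 1` is harmless, as `κ_0 = 0`. -/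
theorem exists_partialDerivs_vec_pow (x : Paravector n) (j : ℕ) :
    ∃ d : Fin n → Cl n, (∀ i, HasDirDeriv (fun y => vec y.2 ^ j) x (0, Pi.single i 1) (d i)) ∧
      ∑ i, e i * d i = -diracFactor n j • vec x.2 ^ (j - 1) := by
  induction j using Nat.twoStepInduction with
  | zero =>
    exact ⟨0, fun i => hasDirDeriv_of_forall_eq (by simp), by simp [diracFactor]⟩
  | one =>
    refine ⟨e, fun i => by simpa [e] using hasDirDeriv_vec x 0 (Pi.single i 1), ?_⟩
    simp [diracFactor, e_mul_e, Nat.cast_smul_eq_nsmul]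
  | more j ih _ =>
    obtain ⟨d, hd, hsum⟩ := ih
    refine ⟨fun i => (-(2 * x.2 i)) • vec x.2 ^ j + (-∑ m, x.2 m ^ 2) • d i, fun i => ?_, ?_⟩
    · simpa only [vec_pow_add_two] using HasDirDeriv.smul (hasDerivAt_sum_sq x i) (hd i)
    · have h₁ : ∑ i, e i * ((-(2 * x.2 i)) • vec x.2 ^ j) = (-2 : ℝ) • vec x.2 ^ (j + 1) := by
        rw [pow_succ', ← smul_mul_assoc]
        conv_rhs => enter [1, 2]; rw [vec_eq_sum]
        rw [Finset.smul_sum, Finset.sum_mul]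
        refine Finset.sum_congr rfl fun i _ => ?_
        rw [mul_smul_comm, smul_smul, smul_mul_assoc, neg_mul]
      simp only [mul_add, Finset.sum_add_distrib, h₁]
      simp only [mul_smul_comm, ← Finset.smul_sum, hsum]
      rcases j with - | j
      · simp [diracFactor]
      · rw [smul_comm, show j + 1 - 1 = j from rfl, ← vec_pow_add_two, diracFactor_add_two,
          show j + 1 + 2 - 1 = j + 2 from rfl, show j + 1 + 1 = j + 2 from rfl, ← add_smul]
        congr 1
        ring

/-! ### Axial homogeneous polynomials -/

/-- The homogeneous polynomial `∑_{j ≤ k} c_j x₀^{k-j} 𝐱^j`. -/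
def axialPoly (n k : ℕ) (c : ℕ → ℝ) (x : Paravector n) : Cl n :=
  ∑ j ∈ Finset.range (k + 1), (c j * x.1 ^ (k - j)) • vec x.2 ^ j

/-- The functions `∑ T_s x^{k-s} x̄^s` are the functions `∑ c_j x₀^{k-j} 𝐱^j`. -/
theorem exists_toCl_conjCl_iff (k : ℕ) (Q : Paravector n → Cl n) :
    (∃ T : ℕ → ℝ, ∀ x, Q x =
      ∑ s ∈ Finset.range (k + 1), T s • (toCl x ^ (k - s) * conjCl x ^ s)) ↔
    ∃ c, Q = axialPoly n k c := by
  -- The change of basis takes place in the ring of functions, so that the coefficients do not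
  -- depend on the point.
  let a : Paravector n → Cl n := fun x => algebraMap ℝ (Cl n) x.1
  let b : Paravector n → Cl n := fun x => vec x.2
  have hab : Commute a b := funext fun x => Algebra.commutes x.1 (vec x.2 : Cl n)
  have hab' : Commute (a + b) (a - b) :=
    ((Commute.refl a).sub_right hab).add_left (hab.symm.sub_right (Commute.refl b))
  have hspan : Submodule.span ℝ {a + b, a - b} = Submodule.span ℝ {a, b} := by
    apply le_antisymm <;> rw [Submodule.span_le] <;> rintro _ (rfl | rfl) <;>
      rw [SetLike.mem_coe, Submodule.mem_span_pair]
    · exact ⟨1, 1, by simp⟩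
    · exact ⟨1, -1, by simp [sub_eq_add_neg]⟩
    · exact ⟨1 / 2, 1 / 2, by module⟩
    · exact ⟨1 / 2, -1 / 2, by module⟩
  have h₁ := mem_span_pair_pow_iff hab k Q
  have h₂ := mem_span_pair_pow_iff hab' k Q
  rw [hspan, h₁] at h₂
  have e₁ : ∀ T : ℕ → ℝ, (∑ s ∈ Finset.range (k + 1), T s • (a ^ (k - s) * b ^ s)) =
      axialPoly n k T := fun T => by
    ext x
    simp [axialPoly, a, b, Finset.sum_apply, ← map_pow, ← Algebra.smul_def, mul_smul]
  have e₂ : ∀ T : ℕ → ℝ, (∀ x, Q x =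
      ∑ s ∈ Finset.range (k + 1), T s • (toCl x ^ (k - s) * conjCl x ^ s)) ↔
      Q = ∑ s ∈ Finset.range (k + 1), T s • ((a + b) ^ (k - s) * (a - b) ^ s) := fun T => by
    rw [funext_iff]
    simp [toCl, conjCl, a, b, Finset.sum_apply]
  simp only [e₁] at h₂
  simp only [e₂]
  exact h₂.symm

theorem axialPoly_one (k : ℕ) (c : ℕ → ℝ) : axialPoly n k c (1, 0) = c 0 • 1 := by
  rw [axialPoly, Finset.sum_eq_single 0]
  · simp
  · intro j _ hj
    simp [vec_zero, hj]
  · simp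

/-- The derivative `∂₀` and the Dirac operator, applied to `∑_{j ≤ k} c_j x₀^{k-j} 𝐱^j`. Both results
are combinations of the `x₀^{k-1-j} 𝐱^j` with `j < k`: the terms lost are the one with `j = k` for
`∂₀` and, as `κ_0 = 0`, the one with `j = 0` for the Dirac operator. -/
theorem exists_partialDerivs_axialPoly (k : ℕ) (c : ℕ → ℝ) (x : Paravector n) :
    ∃ d, HasPartialDerivs (axialPoly n k c) x
        (∑ j ∈ Finset.range k, ((k - j) * c j * x.1 ^ (k - 1 - j)) • vec x.2 ^ j) d ∧
      ∑ i, e i * d i =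
        -∑ j ∈ Finset.range k, (diracFactor n (j + 1) * c (j + 1) * x.1 ^ (k - 1 - j)) •
          vec x.2 ^ j := by
  choose d hd hsum using exists_partialDerivs_vec_pow x
  refine ⟨fun i => ∑ j ∈ Finset.range (k + 1), (c j * x.1 ^ (k - j)) • d j i, ⟨?_, fun i => ?_⟩, ?_⟩
  · have h : ∀ j ∈ Finset.range (k + 1), HasDirDeriv
        (fun y : Paravector n => (c j * y.1 ^ (k - j)) • vec y.2 ^ j) x (1, 0)
        (((k - j) * c j * x.1 ^ (k - 1 - j)) • vec x.2 ^ j) := fun j hj => by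
      have hj' : j ≤ k := Nat.lt_succ_iff.1 (Finset.mem_range.1 hj)
      have h₁ : HasDirDeriv (fun y : Paravector n => vec y.2 ^ j) x (1, 0) 0 :=
        hasDirDeriv_of_forall_eq (by simp)
      have h₂ : HasDerivAt (fun t : ℝ => c j * (x + t • ((1, 0) : Paravector n)).1 ^ (k - j))
          ((k - j) * c j * x.1 ^ (k - 1 - j)) 0 := by
        have := (((hasDerivAt_id (0 : ℝ)).const_add x.1).fun_pow (k - j)).const_mul (c j)
        simp only [id, add_zero, mul_one, Nat.cast_sub hj', Nat.sub_right_comm k j 1] at this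
        refine (this.congr_deriv (by ring)).congr_of_eventuallyEq (.of_forall fun t => ?_)
        simp
      simpa using HasDirDeriv.smul (g := fun y => c j * y.1 ^ (k - j)) h₂ h₁
    have := HasDirDeriv.sum h
    rw [Finset.sum_range_succ] at this
    simp only [sub_self, zero_mul, zero_smul, add_zero] at this
    exact this
  · refine HasDirDeriv.sum fun j _ => ?_
    have h₂ : HasDerivAt (fun t : ℝ => c j *
        (x + t • ((0, Pi.single i 1) : Paravector n)).1 ^ (k - j)) 0 0 := by
      simpa using hasDerivAt_const (0 : ℝ) (c j * x.1 ^ (k - j))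
    simpa using HasDirDeriv.smul (g := fun y => c j * y.1 ^ (k - j)) h₂ (hd j i)
  · simp only [Finset.mul_sum, mul_smul_comm]
    rw [Finset.sum_comm]
    simp only [← Finset.smul_sum, hsum]
    rw [Finset.sum_range_succ', ← Finset.sum_neg_distrib]
    simp only [diracFactor, Even.zero, if_true, Nat.cast_zero, neg_zero, zero_smul, smul_zero,
      add_zero]
    refine Finset.sum_congr rfl fun j _ => ?_
    rw [smul_smul, ← neg_smul, Nat.sub_sub, add_comm 1 j]
    simp only [add_tsub_cancel_right]
    congr 1
    ring

/-- On the line spanned by `e₁`, a vanishing sum `∑ b_j 𝐱^j` is a polynomial in one real variable with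
coefficients `b_j e₁^j`, and `e₁` is a unit. -/
theorem coeff_eq_zero_of_sum_vec_pow_eq_zero (hn : 0 < n) {k : ℕ} {b : ℕ → ℝ}
    (hb : ∀ v : Fin n → ℝ, ∑ j ∈ Finset.range k, b j • vec v ^ j = 0) {j : ℕ} (hj : j < k) :
    b j = 0 := by
  refine (smul_eq_zero.1 (eq_of_forall_dual (b := 0) fun L => ?_)).resolve_right
    (e_pow_ne_zero (⟨0, hn⟩ : Fin n) j)
  let p : ℝ[X] := ∑ i ∈ Finset.range k, Polynomial.monomial i (b i * L (e ⟨0, hn⟩ ^ i))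
  have hp : p = 0 := Polynomial.funext fun t => by
    have := congrArg L (hb (t • Pi.single ⟨0, hn⟩ 1))
    simp only [map_sum, vec_smul, smul_pow, map_smul, map_zero, smul_eq_mul] at this
    simp only [p, Polynomial.eval_finsetSum, Polynomial.eval_monomial, Polynomial.eval_zero]
    rw [← this]
    refine Finset.sum_congr rfl fun i _ => ?_
    rw [e]
    ring
  have := congrArg (fun q => Polynomial.coeff q j) hp
  simpa [p, Polynomial.finsetSum_coeff, Polynomial.coeff_monomial, hj] using this

theorem isMonogenic_axialPoly_iff (hn : 0 < n) (k : ℕ) (c : ℕ → ℝ) :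
    IsMonogenic (axialPoly n k c) ↔
      ∀ j < k, diracFactor n (j + 1) * c (j + 1) = (k - j) * c j := by
  constructor
  · intro h j hj
    rw [← sub_eq_zero, ← neg_eq_zero, neg_sub]
    refine coeff_eq_zero_of_sum_vec_pow_eq_zero
      (b := fun j => (k - j) * c j - diracFactor n (j + 1) * c (j + 1)) hn (fun v => ?_) hj
    obtain ⟨d₀, d, ⟨hd₀, hd⟩, h0⟩ := h (1, v)
    obtain ⟨d', ⟨hd₀', hd'⟩, hsum⟩ := exists_partialDerivs_axialPoly k c (1, v)
    obtain rfl : d = d' := funext fun i => (hd i).unique (hd' i)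
    rw [hsum, hd₀.unique hd₀', ← sub_eq_add_neg, ← Finset.sum_sub_distrib] at h0
    simpa [sub_smul] using h0
  · intro h x
    obtain ⟨d, hd, hsum⟩ := exists_partialDerivs_axialPoly k c x
    refine ⟨_, d, hd, ?_⟩
    rw [hsum, ← sub_eq_add_neg, sub_eq_zero]
    exact Finset.sum_congr rfl fun j hj => by rw [h j (Finset.mem_range.1 hj)]

/-! ### The Appell polynomials -/

theorem diracFactor_succ_pos (hn : 0 < n) (j : ℕ) : 0 < diracFactor n (j + 1) := by
  have : (1 : ℝ) ≤ n := by exact_mod_cast hn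
  rw [diracFactor]
  split_ifs <;> push_cast <;> linarith [(Nat.cast_nonneg j : (0 : ℝ) ≤ j)]

/-- The coefficients of `P_k^n` with respect to `x₀^{k-j} 𝐱^j`, determined by the value `1` at `1`
and the recurrence equivalent to monogenicity. -/
def appellCoeff (n k : ℕ) : ℕ → ℝ
  | 0 => 1
  | j + 1 => (k - j) * appellCoeff n k j / diracFactor n (j + 1)

theorem eq_appellCoeff (hn : 0 < n) {k : ℕ} {c : ℕ → ℝ} (h0 : c 0 = 1)
    (h : ∀ j < k, diracFactor n (j + 1) * c (j + 1) = (k - j) * c j) {j : ℕ} (hj : j ≤ k) :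
    c j = appellCoeff n k j := by
  induction j with
  | zero => exact h0
  | succ j ih =>
    rw [appellCoeff, ← ih (by omega), eq_div_iff (diracFactor_succ_pos hn j).ne', mul_comm]
    exact h j hj

theorem diracFactor_mul_appellCoeff (hn : 0 < n) (k j : ℕ) :
    diracFactor n (j + 1) * appellCoeff n k (j + 1) = (k - j) * appellCoeff n k j := by
  rw [appellCoeff, mul_div_cancel₀ _ (diracFactor_succ_pos hn j).ne']

theorem isAppellPolynomial_iff (hn : 0 < n) (k : ℕ) (Q : Paravector n → Cl n) :
    IsAppellPolynomial n k Q ↔ Q = axialPoly n k (appellCoeff n k) := by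
  rw [IsAppellPolynomial, exists_toCl_conjCl_iff]
  constructor
  · rintro ⟨⟨c, rfl⟩, h1, hm⟩
    rw [axialPoly_one] at h1
    have h0 : c 0 = 1 := by
      have : (c 0 - 1) • (1 : Cl n) = 0 := by rw [sub_smul, h1, one_smul, sub_self]
      exact sub_eq_zero.1 ((smul_eq_zero.1 this).resolve_right one_ne_zero)
    rw [isMonogenic_axialPoly_iff hn] at hm
    ext x
    refine Finset.sum_congr rfl fun j hj => ?_
    rw [eq_appellCoeff hn h0 hm (Nat.lt_succ_iff.1 (Finset.mem_range.1 hj))]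
  · rintro rfl
    refine ⟨⟨_, rfl⟩, ?_, ?_⟩
    · rw [axialPoly_one, appellCoeff, one_smul]
    · exact (isMonogenic_axialPoly_iff hn _ _).2 fun j _ => diracFactor_mul_appellCoeff hn k j

/-- The identity between coefficients that says `∂₀ P_{k+1} = (k + 1) P_k`. -/
theorem sub_mul_appellCoeff (hn : 0 < n) (k j : ℕ) :
    (k + 1 - j) * appellCoeff n (k + 1) j = (k + 1) * appellCoeff n k j := by
  induction j with
  | zero => simp [appellCoeff]
  | succ j ih =>
    have := (diracFactor_succ_pos hn j).ne'
    rw [appellCoeff, appellCoeff]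
    field_simp
    push_cast
    linear_combination (k - j : ℝ) * ih

/-- By monogenicity the Dirac operator contributes `-∂₀`, so the hypercomplex derivative is `∂₀`. -/
theorem hasHypercomplexDeriv_axialPoly (hn : 0 < n) (k : ℕ) (x : Paravector n) :
    HasHypercomplexDeriv (axialPoly n k (appellCoeff n k)) x
      ((k : ℝ) • axialPoly n (k - 1) (appellCoeff n (k - 1)) x) := by
  obtain ⟨d, hd, hsum⟩ := exists_partialDerivs_axialPoly k (appellCoeff n k) x
  refine ⟨_, d, hd, ?_⟩
  simp only [diracFactor_mul_appellCoeff hn] at hsum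
  rw [hsum, sub_neg_eq_add, ← two_smul ℝ, smul_smul]
  rcases k with - | k
  · simp
  · rw [axialPoly, Finset.smul_sum]
    simp only [add_tsub_cancel_right]
    norm_num
    refine Finset.sum_congr rfl fun j _ => ?_
    rw [smul_smul, sub_mul_appellCoeff hn, mul_assoc]

theorem continuousCl_axialPoly (k : ℕ) (c : ℕ → ℝ) : ContinuousCl (axialPoly n k c) := by
  intro L
  have hvec : ∀ j, Continuous fun x : Paravector n => L (vec x.2 ^ j) := fun j => by
    induction j using Nat.twoStepInduction with
    | zero => simpa using continuous_const
    | one =>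
      simp only [pow_one, vec_eq_sum, map_sum, map_smul, smul_eq_mul]
      fun_prop
    | more j ih _ =>
      simp only [vec_pow_add_two, map_smul, smul_eq_mul]
      exact Continuous.mul (by fun_prop) ih
  simp only [axialPoly, map_sum, map_smul, smul_eq_mul]
  exact continuous_finsetSum _ fun j _ => Continuous.mul (by fun_prop) (hvec j)

theorem ContinuousCl.eq_of_eq_of_ne_zero (hn : 0 < n) {F G : Paravector n → Cl n}
    (hF : ContinuousCl F) (hG : ContinuousCl G)
    (h : ∀ x : Paravector n, x.2 ≠ 0 → F x = G x) : F = G := by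
  have : Nonempty (Fin n) := ⟨⟨0, hn⟩⟩
  have hd : Dense {x : Paravector n | x.2 ≠ 0} :=
    (dense_compl_singleton (0 : Fin n → ℝ)).preimage isOpenMap_snd
  refine funext fun x => eq_of_forall_dual fun L => ?_
  exact congrFun (Continuous.ext_on hd (hF L) (hG L) fun y hy => congrArg L (h y hy)) x

/-! ### Even and odd parts -/

/-- The even part of `∑_{j < 2N} c_j w^{k-j} b^j`, for `b ^ 2 = -q`, as a polynomial in `q`. -/
def evenPoly (k N : ℕ) (c : ℕ → ℝ) (w : ℝ) : ℝ[X] :=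
  ∑ i ∈ Finset.range N, Polynomial.monomial i ((-1) ^ i * (c (2 * i) * w ^ (k - 2 * i)))

/-- The odd part of `∑_{j < 2N} c_j w^{k-j} b^j`, for `b ^ 2 = -q`, divided by `b`, as a polynomial
in `q`. -/
def oddPoly (k N : ℕ) (c : ℕ → ℝ) (w : ℝ) : ℝ[X] :=
  ∑ i ∈ Finset.range N,
    Polynomial.monomial i ((-1) ^ i * (c (2 * i + 1) * w ^ (k - (2 * i + 1))))

theorem coeff_evenPoly (k N : ℕ) (c : ℕ → ℝ) (w : ℝ) (i : ℕ) :
    (evenPoly k N c w).coeff i =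
      if i < N then (-1) ^ i * (c (2 * i) * w ^ (k - 2 * i)) else 0 := by
  simp [evenPoly, Polynomial.finsetSum_coeff, Polynomial.coeff_monomial]

theorem coeff_oddPoly (k N : ℕ) (c : ℕ → ℝ) (w : ℝ) (i : ℕ) :
    (oddPoly k N c w).coeff i =
      if i < N then (-1) ^ i * (c (2 * i + 1) * w ^ (k - (2 * i + 1))) else 0 := by
  simp [oddPoly, Polynomial.finsetSum_coeff, Polynomial.coeff_monomial]

/-- Separation of even and odd powers of an element `b` with `b ^ 2 = -q`. It applies to `b = i r` in
`ℂ` and to `b = 𝐱` in `Cℓ(n)`, which links the powers of `w + i r` with the polynomials in `x₀`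
and `𝐱`. -/
theorem sum_eq_evenPoly_add_oddPoly {A : Type*} [Ring A] [Algebra ℝ A] {b : A} {q : ℝ}
    (hb : b ^ 2 = -q • (1 : A)) {k N : ℕ} {c : ℕ → ℝ} (hc : ∀ j, k < j → c j = 0)
    (hN : k < 2 * N) (w : ℝ) :
    ∑ j ∈ Finset.range (k + 1), (c j * w ^ (k - j)) • b ^ j =
      (evenPoly k N c w).eval q • (1 : A) + (oddPoly k N c w).eval q • b := by
  have hpow : ∀ i, b ^ (2 * i) = ((-1) ^ i * q ^ i) • (1 : A) := fun i => by
    rw [pow_mul, hb, smul_pow, one_pow, neg_pow]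
  have hext : ∑ j ∈ Finset.range (k + 1), (c j * w ^ (k - j)) • b ^ j =
      ∑ j ∈ Finset.range (2 * N), (c j * w ^ (k - j)) • b ^ j := by
    refine Finset.sum_subset (Finset.range_subset_range.2 hN) fun j _ hj => ?_
    rw [hc j (by simpa using hj), zero_mul, zero_smul]
  rw [hext]
  clear hext hc hN
  simp only [evenPoly, oddPoly, Polynomial.eval_finsetSum, Polynomial.eval_monomial]
  induction N with
  | zero => simp
  | succ N ih =>
    rw [show 2 * (N + 1) = 2 * N + 1 + 1 by ring, Finset.sum_range_succ, Finset.sum_range_succ, ih,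
      Finset.sum_range_succ, Finset.sum_range_succ, pow_succ b, hpow, smul_mul_assoc, one_mul]
    module

theorem complex_pow_eq (l : ℕ) (w r : ℝ) :
    (⟨w, r⟩ : ℂ) ^ l =
      ⟨(evenPoly l (l + 1) (fun j => l.choose j) w).eval (r ^ 2),
        r * (oddPoly l (l + 1) (fun j => l.choose j) w).eval (r ^ 2)⟩ := by
  have hb : (r * Complex.I) ^ 2 = -(r ^ 2) • (1 : ℂ) := by
    rw [mul_pow, Complex.I_sq]
    simp
  have h := sum_eq_evenPoly_add_oddPoly (k := l) (N := l + 1) (c := fun j => (l.choose j : ℝ)) hb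
    (fun j hj => by simp [Nat.choose_eq_zero_of_lt hj]) (by omega) w
  have hz : (⟨w, r⟩ : ℂ) = r * Complex.I + w := by apply Complex.ext <;> simp
  have hsum : (⟨w, r⟩ : ℂ) ^ l = ∑ j ∈ Finset.range (l + 1),
      ((l.choose j : ℝ) * w ^ (l - j)) • (r * Complex.I) ^ j := by
    rw [hz, add_pow]
    refine Finset.sum_congr rfl fun j _ => ?_
    rw [Complex.real_smul]
    push_cast
    ring
  rw [hsum, h]
  apply Complex.ext <;> simp [mul_comm]

/-- Differentiating `m` times in `q = r²` shifts the exponents `j` by `2m`; for even and for odd `j`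
alike the coefficient is multiplied by the falling factorial of `⌊j/2⌋ + m`. -/
theorem iterate_derivative_evenPoly (k N m : ℕ) (c : ℕ → ℝ) (w : ℝ) :
    Polynomial.derivative^[m] (evenPoly (k + 2 * m) (N + m) c w) =
      evenPoly k N (fun j => (-1) ^ m * (c (j + 2 * m) * (j / 2 + m).descFactorial m)) w := by
  ext i
  rw [Polynomial.coeff_iterate_derivative, coeff_evenPoly, coeff_evenPoly]
  simp only [Nat.add_lt_add_iff_right, nsmul_eq_mul]
  split_ifs
  · rw [show 2 * (i + m) = 2 * i + 2 * m by ring, Nat.add_sub_add_right,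
      show 2 * i / 2 = i by omega]
    ring
  · simp

theorem iterate_derivative_oddPoly (k N m : ℕ) (c : ℕ → ℝ) (w : ℝ) :
    Polynomial.derivative^[m] (oddPoly (k + 2 * m) (N + m) c w) =
      oddPoly k N (fun j => (-1) ^ m * (c (j + 2 * m) * (j / 2 + m).descFactorial m)) w := by
  ext i
  rw [Polynomial.coeff_iterate_derivative, coeff_oddPoly, coeff_oddPoly]
  simp only [Nat.add_lt_add_iff_right, nsmul_eq_mul]
  split_ifs
  · rw [show 2 * (i + m) + 1 = 2 * i + 1 + 2 * m by ring, Nat.add_sub_add_right,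
      show (2 * i + 1) / 2 = i by omega]
    ring
  · simp

/-! ### The radial operators -/

theorem hasDerivAt_eval_sq (p : ℝ[X]) (r : ℝ) :
    HasDerivAt (fun s : ℝ => p.eval (s ^ 2)) (p.derivative.eval (r ^ 2) * (2 * r)) r := by
  simpa [Function.comp_def] using (p.hasDerivAt (r ^ 2)).comp r (hasDerivAt_pow 2 r)

/-- On even functions `p(r²)` the operator `(1/r) ∂_r` is `2 d/dq` in the variable `q = r²`. -/
theorem iterate_invMulDeriv (m : ℕ) (p : ℝ[X]) {r : ℝ} (hr : 0 < r) :
    (invMulDeriv^[m] fun s => p.eval (s ^ 2)) r =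
      2 ^ m * (Polynomial.derivative^[m] p).eval (r ^ 2) := by
  induction m generalizing r with
  | zero => simp
  | succ m ih =>
    have h : (invMulDeriv^[m] fun s => p.eval (s ^ 2)) =ᶠ[nhds r]
        fun s => 2 ^ m * (Polynomial.derivative^[m] p).eval (s ^ 2) :=
      Filter.eventually_of_mem (Ioi_mem_nhds hr) fun s hs => ih hs
    rw [Function.iterate_succ_apply', Function.iterate_succ_apply', invMulDeriv, h.deriv_eq,
      ((hasDerivAt_eval_sq _ r).const_mul _).deriv]
    field_simp
    ring

/-- On odd functions `r p(r²)` the operator `∂_r (1/r)` is `2 d/dq`, applied to `p`, in the variable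
`q = r²`. -/
theorem iterate_derivInvMul (m : ℕ) (p : ℝ[X]) {r : ℝ} (hr : 0 < r) :
    (derivInvMul^[m] fun s => s * p.eval (s ^ 2)) r =
      r * (2 ^ m * (Polynomial.derivative^[m] p).eval (r ^ 2)) := by
  induction m generalizing r with
  | zero => simp
  | succ m ih =>
    have h : (fun s => 1 / s * (derivInvMul^[m] fun s => s * p.eval (s ^ 2)) s) =ᶠ[nhds r]
        fun s => 2 ^ m * (Polynomial.derivative^[m] p).eval (s ^ 2) :=
      Filter.eventually_of_mem (Ioi_mem_nhds hr) fun s (hs : 0 < s) => by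
        simp only [ih hs]
        field_simp
    rw [Function.iterate_succ_apply', Function.iterate_succ_apply', derivInvMul, h.deriv_eq,
      ((hasDerivAt_eval_sq _ r).const_mul _).deriv]
    ring

/-! ### The Fueter–Sce transform of a power -/

theorem appellCoeff_eq_zero {k j : ℕ} (hj : k < j) : appellCoeff n k j = 0 := by
  induction j, hj using Nat.le_induction with
  | base => simp [appellCoeff]
  | succ j _ ih => simp [appellCoeff, ih]

/-- The normalisation of the Fueter–Sce transform: the coefficient of `x₀^k` is `1`. -/
theorem alpha_mul_two_pow_mul_choose {m : ℕ} (hm : 0 < m) (k : ℕ) :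
    alpha (2 * m + 1) (k + 2 * m) * 2 ^ m *
      ((-1) ^ m * ((k + 2 * m).choose (2 * m) * m.factorial)) = 1 := by
  obtain ⟨m, rfl⟩ := Nat.exists_eq_add_of_lt hm
  simp only [zero_add]
  have h₁ : ((2 * (m + 1)).factorial : ℝ) =
      2 ^ (m + 1) * (m + 1).factorial * (2 * m + 1).doubleFactorial := by
    rw [show 2 * (m + 1) = 2 * m + 1 + 1 by ring, Nat.factorial_eq_mul_doubleFactorial,
      show 2 * m + 1 + 1 = 2 * (m + 1) by ring, Nat.doubleFactorial_two_mul]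
    push_cast
    rfl
  have h₂ : ((k + 2 * (m + 1)).choose (2 * (m + 1)) : ℝ) * k.factorial *
      (2 * (m + 1)).factorial = (k + 2 * (m + 1)).factorial := by
    exact_mod_cast Nat.add_choose_mul_factorial_mul_factorial k (2 * (m + 1))
  have h₃ : ((-1 : ℝ) ^ (m + 1)) * (-1) ^ (m + 1) = 1 := by rw [← mul_pow]; simp
  have h₄ : ((k + 2 * (m + 1)).factorial : ℝ) ≠ 0 := by positivity
  rw [alpha, show (2 * (m + 1) + 1 - 1) / 2 = m + 1 by omega,
    show 2 * (m + 1) + 1 - 2 = 2 * m + 1 by omega,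
    show k + 2 * (m + 1) + 1 - (2 * (m + 1) + 1) = k by omega, div_mul_eq_mul_div,
    div_mul_eq_mul_div, div_eq_one_iff_eq h₄, ← h₂, h₁]
  linear_combination ((2 * m + 1).doubleFactorial * k.factorial * 2 ^ (m + 1) *
    (k + 2 * (m + 1)).choose (2 * (m + 1)) * (m + 1).factorial : ℝ) * h₃

theorem diracFactor_mul_descFactorial (m j : ℕ) :
    diracFactor (2 * m + 1) (j + 1) * ((j + 1) / 2 + m).descFactorial m =
      (j + 1 + 2 * m) * ((j / 2 + m).descFactorial m : ℝ) := by
  rcases Nat.even_or_odd' j with ⟨i, rfl | rfl⟩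
  · rw [show (2 * i + 1) / 2 = i by omega, show 2 * i / 2 = i by omega, diracFactor,
      if_neg (by simp)]
    push_cast
    ring
  · rw [show (2 * i + 1 + 1) / 2 = i + 1 by omega, show (2 * i + 1) / 2 = i by omega, diracFactor,
      if_pos (by simp [Nat.even_add_one])]
    have h := Nat.succ_descFactorial (i + m) m
    rw [show i + m + 1 - m = i + 1 by omega, show i + m + 1 = i + 1 + m by omega] at h
    have h' : ((i + 1 : ℝ)) * (i + 1 + m).descFactorial m =
        (i + 1 + m) * (i + m).descFactorial m := by exact_mod_cast h
    push_cast
    linear_combination 2 * h'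

/-- The coefficients of the transform of `z^{k+2m}` have the value `1` at `j = 0` and satisfy the
recurrence of the Appell coefficients. -/
theorem alpha_mul_choose_eq_appellCoeff {m : ℕ} (hm : 0 < m) (k j : ℕ) :
    alpha (2 * m + 1) (k + 2 * m) * 2 ^ m *
      ((-1) ^ m * ((k + 2 * m).choose (j + 2 * m) * (j / 2 + m).descFactorial m)) =
      appellCoeff (2 * m + 1) k j := by
  rcases lt_or_ge k j with hj | hj
  · rw [appellCoeff_eq_zero hj, Nat.choose_eq_zero_of_lt (by omega)]
    simp
  refine eq_appellCoeff (c := fun j => alpha (2 * m + 1) (k + 2 * m) * 2 ^ m *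
      ((-1) ^ m * ((k + 2 * m).choose (j + 2 * m) * (j / 2 + m).descFactorial m)))
    (by omega) ?_ (fun i hi => ?_) hj
  · simpa [Nat.descFactorial_self] using alpha_mul_two_pow_mul_choose hm k
  · have h := Nat.choose_succ_right_eq (k + 2 * m) (i + 2 * m)
    rw [Nat.add_sub_add_right, show i + 2 * m + 1 = i + 1 + 2 * m by ring] at h
    have h' : ((k + 2 * m).choose (i + 1 + 2 * m) : ℝ) * (i + 1 + 2 * m) =
        (k + 2 * m).choose (i + 2 * m) * (k - i) := by
      rw [← Nat.cast_sub hi.le]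
      exact_mod_cast h
    have h₂ := diracFactor_mul_descFactorial m i
    linear_combination alpha (2 * m + 1) (k + 2 * m) * 2 ^ m * (-1) ^ m *
      ((k + 2 * m).choose (i + 1 + 2 * m) * h₂ + (i / 2 + m).descFactorial m * h')

theorem fueterSceFormula_pow {m : ℕ} (hm : 0 < m) (k : ℕ) {x : Paravector (2 * m + 1)}
    (hx : x.2 ≠ 0) :
    fueterSceFormula (2 * m + 1) (alpha (2 * m + 1) (k + 2 * m)) (fun z => z ^ (k + 2 * m)) x =
      axialPoly (2 * m + 1) k (appellCoeff (2 * m + 1) k) x := by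
  have hr := vecNorm_pos hx
  have hb : vec x.2 ^ 2 = -(vecNorm x.2 ^ 2) • (1 : Cl (2 * m + 1)) := by
    rw [vec_sq, vecNorm_sq]
  -- Each of the `m` derivatives in `q` removes one of the `k + 2 * m + 1` coefficients.
  have hN : k + 2 * m + 1 = (k + m + 1) + m := by ring
  simp only [fueterSceFormula, complex_pow_eq, show (2 * m + 1 - 1) / 2 = m by omega,
    iterate_invMulDeriv m _ hr, iterate_derivInvMul m _ hr, hN, iterate_derivative_evenPoly,
    iterate_derivative_oddPoly]
  have hsum := sum_eq_evenPoly_add_oddPoly hb (k := k) (N := k + m + 1)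
    (c := fun j => (-1) ^ m * ((k + 2 * m).choose (j + 2 * m) * (j / 2 + m).descFactorial m))
    (fun j hj => by rw [Nat.choose_eq_zero_of_lt (by omega)]; simp) (by omega) x.1
  rw [← Algebra.commutes, ← Algebra.smul_def, smul_smul, Algebra.algebraMap_eq_smul_one,
    mul_right_comm, mul_one_div_cancel hr.ne', one_mul, mul_smul, mul_smul, ← smul_add, smul_smul,
    ← hsum, Finset.smul_sum, axialPoly]
  refine Finset.sum_congr rfl fun j _ => ?_
  rw [smul_smul, ← mul_assoc, alpha_mul_choose_eq_appellCoeff hm]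

theorem isFueterSceTransform_pow_iff {m : ℕ} (hm : 0 < m) (k : ℕ)
    (τ : Paravector (2 * m + 1) → Cl (2 * m + 1)) :
    IsFueterSceTransform (2 * m + 1) (alpha (2 * m + 1) (k + 2 * m)) (fun z => z ^ (k + 2 * m)) τ ↔
      τ = axialPoly (2 * m + 1) k (appellCoeff (2 * m + 1) k) := by
  constructor
  · rintro ⟨h, hτ⟩
    refine hτ.eq_of_eq_of_ne_zero (by omega) (continuousCl_axialPoly k _) fun x hx => ?_
    rw [h x hx, fueterSceFormula_pow hm k hx]
  · rintro rfl
    exact ⟨fun x hx => (fueterSceFormula_pow hm k hx).symm, continuousCl_axialPoly k _⟩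

end

end FueterSce

/-- For odd `n > 1` there is, for every `k`, exactly one polynomial `P k` with the defining
properties of the Malonek–Cruz–Falcão polynomial `P_k^n`; these form an Appell sequence; and the
Fueter–Sce transform of `z^{k+n-1}`, with the normalisation `alpha`, exists and is `P k`. -/
theorem theorem1 (n : ℕ) (hn : Odd n) (hn1 : 1 < n) :
    ∃ P : ℕ → FueterSce.Paravector n → FueterSce.Cl n,
      (∀ (k : ℕ) (Q : FueterSce.Paravector n → FueterSce.Cl n),
        FueterSce.IsAppellPolynomial n k Q ↔ Q = P k) ∧
      (∀ (k : ℕ) (x : FueterSce.Paravector n),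
        FueterSce.HasHypercomplexDeriv (P k) x ((k : ℝ) • P (k - 1) x)) ∧
      (∀ (k : ℕ) (τ : FueterSce.Paravector n → FueterSce.Cl n),
        FueterSce.IsFueterSceTransform n (FueterSce.alpha n (k + n - 1))
          (fun z : ℂ => z ^ (k + n - 1)) τ ↔ τ = P k) := by
  obtain ⟨m, rfl⟩ := hn
  exact ⟨fun k => FueterSce.axialPoly _ k (FueterSce.appellCoeff _ k),
    FueterSce.isAppellPolynomial_iff (by omega),
    FueterSce.hasHypercomplexDeriv_axialPoly (by omega),
    FueterSce.isFueterSceTransform_pow_iff (by omega)⟩
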